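/- Let $\Gamma$ be a (simple, possibly infinite) graph with vertex set $V(\Gamma)$, and let $$A(\Gamma)=\langle u\in V(\Gamma)\mid uv=vu \text{ for every edge } \{u,v\} \text{ of } \Gamma\rangle$$ be its right-angled Artin group. Let $\mathrm{QM}(\Gamma)$ be the Cayley graph of $A(\Gamma)$ with respect to the generating set $\{u^k \mid u\in V(\Gamma),\ k\in\mathbb{Z}\setminus\{0\}\}$, with edges joining $g$ and $gu^k$. A hyperplane of $\mathrm{QM}(\Gamma)$ is an equivalence class of edges for the equivalence relation generated by identifying two edges whenever they belong to a common $3$-cycle or are opposite sides of a $4$-cycle. Two distinct hyperplanes are transverse if some $4$-cycle has one pair of opposite sides in the first and the other pair in the second. Let $\mathscr{C}(\Gamma)$ be the crossing graph of all hyperplanes of $\mathrm{QM}(\Gamma)$: its vertices are the hyperplanes, and two distinct hyperplanes are adjacent if and only if they are transverse. (i) $\mathscr{C}(\Gamma)$ is the extension graph of $\Gamma$, that is, the graph whose vertices are the conjugates in $A(\Gamma)$ of the elements of $V(\Gamma)$ and in which two distinct conjugates are adjacent if and only if they commute: there is a graph isomorphism from $\mathscr{C}(\Gamma)$ to the extension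 graph that sends the hyperplane containing an edge $\{g,gu^k\}$ (where $g\in A(\Gamma)$, $u\in V(\Gamma)$, $k\neq 0$) to $gug^{-1}$. (ii) For every finite induced subgraph $\Lambda$ of $\mathscr{C}(\Gamma)$, the group $A(\Gamma)$ contains a subgroup isomorphic to $A(\Lambda)$. -/

import Mathlib

/-- The relators of the right-angled Artin group of `G`: the commutators of adjacent vertices. -/
def raagRelators {V : Type*} (G : SimpleGraph V) : Set (FreeGroup V) :=
  {r | ∃ u v : V, G.Adj u v ∧
    r = FreeGroup.of u * FreeGroup.of v * (FreeGroup.of u)⁻¹ * (FreeGroup.of v)⁻¹}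

/-- The right-angled Artin group `A(G) = ⟨u ∈ V(G) ∣ [u, v] = 1 for {u, v} ∈ E(G)⟩`. -/
abbrev RAAG {V : Type*} (G : SimpleGraph V) : Type _ := PresentedGroup (raagRelators G)

/-- The generator of `A(G)` given by a vertex of `G`. -/
def RAAG.of {V : Type*} (G : SimpleGraph V) (u : V) : RAAG G :=
  PresentedGroup.of u

/-- `QM(G)`: the Cayley graph of `A(G)` for the generating set of all non-trivial powers
`u ^ k` of vertices, with edges joining `g` and `g * u ^ k`. -/
def qmGraph {V : Type*} (G : SimpleGraph V) : SimpleGraph (RAAG G) :=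
  SimpleGraph.mulCayley {s : RAAG G | ∃ (u : V) (k : ℤ), k ≠ 0 ∧ s = RAAG.of G u ^ k}

/-- `a, b, c, d` are, in this cyclic order, the vertices of a `4`-cycle of `X`. -/
structure IsFourCycle {W : Type*} (X : SimpleGraph W) (a b c d : W) : Prop where
  adj_ab : X.Adj a b
  adj_bc : X.Adj b c
  adj_cd : X.Adj c d
  adj_da : X.Adj d a
  ne_ac : a ≠ c
  ne_bd : b ≠ d

/-- The elementary relation on edges that generates parallelism. -/
inductive EdgeStep {W : Type*} (X : SimpleGraph W) : X.edgeSet → X.edgeSet → Prop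
  /-- Two (distinct) edges of a `3`-cycle with vertices `a, b, c`. -/
  | triangle (a b c : W) (hab : X.Adj a b) (hac : X.Adj a c) (hbc : X.Adj b c) :
      EdgeStep X ⟨s(a, b), hab⟩ ⟨s(a, c), hac⟩
  /-- Two opposite sides of a `4`-cycle with vertices `a, b, c, d`. -/
  | square (a b c d : W) (h : IsFourCycle X a b c d) :
      EdgeStep X ⟨s(a, b), h.adj_ab⟩ ⟨s(c, d), h.adj_cd⟩

/-- The hyperplanes of `X`: the classes of edges for the equivalence relation generated by
identifying edges of a common `3`-cycle and opposite sides of a `4`-cycle. -/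
def Hyperplane {W : Type*} (X : SimpleGraph W) : Type _ :=
  Quotient (Relation.EqvGen.setoid (EdgeStep X))

/-- The hyperplane `J` contains the pair `e` of vertices (which is then an edge). -/
def Hyperplane.Contains {W : Type*} {X : SimpleGraph W} (J : Hyperplane X) (e : Sym2 W) : Prop :=
  ∃ he : e ∈ X.edgeSet, Quotient.mk (Relation.EqvGen.setoid (EdgeStep X)) ⟨e, he⟩ = J

/-- Two hyperplanes are transverse if they contain the two distinct pairs of opposite sides of
some `4`-cycle. -/
def Hyperplane.Transverse {W : Type*} {X : SimpleGraph W} (J K : Hyperplane X) : Prop :=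
  ∃ a b c d : W, IsFourCycle X a b c d ∧
    J.Contains s(a, b) ∧ J.Contains s(c, d) ∧ K.Contains s(b, c) ∧ K.Contains s(d, a)

theorem Hyperplane.Transverse.symm {W : Type*} {X : SimpleGraph W} {J K : Hyperplane X}
    (h : J.Transverse K) : K.Transverse J := by
  obtain ⟨a, b, c, d, hc, h1, h2, h3, h4⟩ := h
  exact ⟨b, c, d, a, ⟨hc.adj_bc, hc.adj_cd, hc.adj_da, hc.adj_ab, hc.ne_bd, hc.ne_ac.symm⟩,
    h3, h4, h2, h1⟩

/-- The crossing graph of all the hyperplanes of `X`: distinct hyperplanes are joined by an edge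
when they are transverse. -/
def crossingGraph {W : Type*} (X : SimpleGraph W) : SimpleGraph (Hyperplane X) where
  Adj J K := J ≠ K ∧ J.Transverse K
  symm := ⟨fun _ _ h => ⟨h.1.symm, h.2.symm⟩⟩
  loopless := ⟨fun _ h => h.1 rfl⟩

/-- The extension graph of `G`: its vertices are the conjugates in `A(G)` of the vertices of `G`,
and two distinct conjugates are joined by an edge when they commute. -/
def extensionGraph {V : Type*} (G : SimpleGraph V) :
    SimpleGraph {x : RAAG G // ∃ (g : RAAG G) (u : V), x = g * RAAG.of G u * g⁻¹} where
  Adj x y := x ≠ y ∧ Commute x.1 y.1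
  symm := ⟨fun _ _ h => ⟨h.1.symm, h.2.symm⟩⟩
  loopless := ⟨fun _ h => h.1 rfl⟩

/-!
The argument rests on one cocycle. An edge `{g, g * u ^ k}` of `QM(G)` is labelled by the conjugate
`g * u * g⁻¹`; counting with signs the letters of a word for `g` whose edge has label `y` gives an
integer `crossing G g y` that depends on `g` only, because `u ↦ (indicator of u, u)` respects the
relations of `A(G)` and so extends to a homomorphism into the semidirect product of the functions on
`A(G)` by `A(G)` acting by conjugation. For a label `y` this integer is the index of the sector of
the hyperplane of `y` that contains `g`. The cocycle identity and the finiteness of its support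
yield what is needed about sectors: a nonzero power of a conjugate of a vertex has the same
centralizer as the conjugate (`commute_conj_of_commute_zpow`), an element commuting with `u` only
crosses hyperplanes whose labels commute with `u` (`commute_of_crossing_ne_zero`), and if two labels
do not commute then each of the two hyperplanes lies in a single sector of the other, every vertex
being in one of these two sectors (`crossing_eq_or_crossing_eq`).

These facts feed a ping-pong lemma (`PingPong.exists_head`, `PingPong.injective`). Applied to the
action of `A(G)` on itself and to the hyperplanes of the generators, it says that a nontrivial
element starts with a power of a vertex whose exponent is read off from the cocycle. Peeling off such
powers shows that the centralizer of `u` is generated by the vertices commuting with `u`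
(`centralizer_induction`), and that a conjugate of `v` commuting with `u` is conjugate to `v` by an
element commuting with `u` (`exists_conj_of_commute`). The first statement makes the label of a
hyperplane a complete invariant, the second produces a square of `QM(G)` for two commuting labels;
together they identify the crossing graph with the extension graph. Applied to large powers of
finitely many conjugates of vertices, the same lemma shows that these powers generate the
right-angled Artin group of the graph of commutation of the conjugates (`exists_injective_hom`).
-/

namespace RAAG

/-! ### Generators, exponent sums and commutation of vertices -/

section Basic

variable {V : Type*} {G : SimpleGraph V}

theorem commute_of_of_adj {u v : V} (h : G.Adj u v) : Commute (of G u) (of G v) := by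
  have h1 : (PresentedGroup.mk (raagRelators G))
      (FreeGroup.of u * FreeGroup.of v * (FreeGroup.of u)⁻¹ * (FreeGroup.of v)⁻¹) = 1 :=
    PresentedGroup.one_of_mem ⟨u, v, h, rfl⟩
  simp only [map_mul, map_inv] at h1
  have h2 := mul_inv_eq_one.1 h1
  exact mul_inv_eq_iff_eq_mul.1 h2

/-- The universal property of `A(G)`. -/
def lift {H : Type*} [Group H] (f : V → H) (hf : ∀ u v, G.Adj u v → Commute (f u) (f v)) :
    RAAG G →* H :=
  PresentedGroup.toGroup (f := f) (by
    rintro r ⟨u, v, huv, rfl⟩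
    simp only [map_mul, map_inv, FreeGroup.lift_apply_of]
    rw [(hf u v huv).eq]
    group)

@[simp]
theorem lift_of {H : Type*} [Group H] (f : V → H) (hf : ∀ u v, G.Adj u v → Commute (f u) (f v))
    (u : V) : lift f hf (of G u) = f u :=
  PresentedGroup.toGroup.of _

/-- Induction along words, letters being appended on the right. -/
theorem induction_right {p : RAAG G → Prop} (one : p 1)
    (mul : ∀ h u, p h → p (h * of G u)) (mul_inv : ∀ h u, p h → p (h * (of G u)⁻¹))
    (g : RAAG G) : p g := by
  have hg : g ∈ Subgroup.closure (Set.range (PresentedGroup.of (rels := raagRelators G))) := by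
    rw [PresentedGroup.closure_range_of]; trivial
  induction hg using Subgroup.closure_induction_right with
  | one => exact one
  | mul_right x _ y hy ih => obtain ⟨u, rfl⟩ := hy; exact mul _ _ ih
  | mul_inv_cancel x _ y hy ih => obtain ⟨u, rfl⟩ := hy; exact mul_inv _ _ ih

open Classical in
/-- The exponent sum of the letter `u`, as a homomorphism `A(G) → ℤ`. -/
noncomputable def expSum (G : SimpleGraph V) (u : V) : RAAG G →* Multiplicative ℤ :=
  lift (fun v => if v = u then Multiplicative.ofAdd 1 else 1) fun _ _ _ => Commute.all _ _

open Classical in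
theorem toAdd_expSum_of_zpow (u v : V) (k : ℤ) :
    (expSum G u (of G v ^ k)).toAdd = if v = u then k else 0 := by
  rw [map_zpow, expSum, lift_of]
  split_ifs <;> simp

theorem of_zpow_ne_one (u : V) {k : ℤ} (hk : k ≠ 0) : of G u ^ k ≠ 1 := by
  intro h
  have := toAdd_expSum_of_zpow (G := G) u u k
  simp [h] at this
  exact hk this.symm

/-- Conjugate generators are equal: the exponent sums tell them apart. -/
theorem eq_of_conj_eq {u v : V} {g h : RAAG G}
    (e : g * of G u * g⁻¹ = h * of G v * h⁻¹) : u = v := by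
  classical
  have h1 := toAdd_expSum_of_zpow (G := G) u u 1
  have h2 := toAdd_expSum_of_zpow (G := G) u v 1
  have h3 := congrArg (fun x => (expSum G u x).toAdd) e
  simp only [map_mul, map_inv, toAdd_mul, toAdd_inv] at h3
  simp only [zpow_one, if_true] at h1 h2
  by_contra hne
  rw [if_neg (Ne.symm hne)] at h2
  omega

theorem of_injective : Function.Injective (of G) := fun u v h =>
  eq_of_conj_eq (g := 1) (h := 1) (by rw [h])

/-- Distinct vertices with commuting generators are adjacent: otherwise there is a homomorphism to
the symmetric group on three letters sending them to two transpositions that do not commute. -/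
theorem adj_of_commute {u v : V} (huv : u ≠ v) (h : Commute (of G u) (of G v)) : G.Adj u v := by
  classical
  by_contra hadj
  let f : V → Equiv.Perm (Fin 3) := fun w =>
    if w = u then Equiv.swap 0 1 else if w = v then Equiv.swap 1 2 else 1
  have hf : ∀ a b, G.Adj a b → Commute (f a) (f b) := by
    intro a b hab
    have h1 : ¬ (a = u ∧ b = v) := by rintro ⟨rfl, rfl⟩; exact hadj hab
    have h2 : ¬ (a = v ∧ b = u) := by rintro ⟨rfl, rfl⟩; exact hadj hab.symm
    simp only [f]
    split_ifs <;> simp_all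
  have h3 := h.map (lift f hf)
  simp only [lift_of, f, if_true, if_neg huv.symm] at h3
  exact absurd h3.eq (by decide)

end Basic

/-! ### The crossing cocycle -/

section Crossing

variable {V : Type*} (G : SimpleGraph V)

/-- The action of `A(G)` by conjugation on itself, turned into an action on functions. -/
noncomputable def conjAut : RAAG G →* MulAut (RAAG G → Multiplicative ℤ) :=
  (mulAutArrow (G := ConjAct (RAAG G)) (A := RAAG G) (M := Multiplicative ℤ)).comp
    (ConjAct.toConjAct (G := RAAG G)).toMonoidHom

theorem conjAut_apply (g : RAAG G) (f : RAAG G → Multiplicative ℤ) (y : RAAG G) :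
    conjAut G g f y = f (g⁻¹ * y * g) := by
  change f ((ConjAct.toConjAct g)⁻¹ • y) = _
  rw [← map_inv, ConjAct.toConjAct_smul, inv_inv]

open Classical in
/-- The homomorphism from `A(G)` to the semidirect product of the functions on `A(G)` by `A(G)`
that sends a vertex `u` to the pair of the indicator function of `u` and `u`. -/
noncomputable def crossingHom :
    RAAG G →* (RAAG G → Multiplicative ℤ) ⋊[conjAut G] RAAG G :=
  lift (fun u => ⟨Pi.mulSingle (of G u) (Multiplicative.ofAdd 1), of G u⟩) (by
    intro u v huv
    have hc := commute_of_of_adj huv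
    have key : ∀ {a b : V}, Commute (of G a) (of G b) →
        conjAut G (of G a) (Pi.mulSingle (of G b) (Multiplicative.ofAdd 1)) =
          Pi.mulSingle (of G b) (Multiplicative.ofAdd 1) := by
      intro a b hab
      funext y
      rw [conjAut_apply]
      simp only [Pi.mulSingle_apply]
      congr 1
      rw [eq_iff_iff, mul_assoc, inv_mul_eq_iff_eq_mul, hab.eq, mul_left_inj]
    apply SemidirectProduct.ext
    · simp only [SemidirectProduct.mul_left, key hc, key hc.symm, mul_comm]
    · exact hc)

open Classical in
theorem crossingHom_of (u : V) : crossingHom G (of G u) =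
    ⟨Pi.mulSingle (of G u) (Multiplicative.ofAdd 1), of G u⟩ :=
  lift_of _ _ u

theorem crossingHom_right (g : RAAG G) : (crossingHom G g).right = g := by
  have : (SemidirectProduct.rightHom (φ := conjAut G)).comp (crossingHom G) =
      MonoidHom.id (RAAG G) := by
    apply PresentedGroup.ext
    intro u
    change (crossingHom G (of G u)).right = of G u
    rw [crossingHom_of]
  exact DFunLike.congr_fun this g

/-- The crossing cocycle. For a conjugate `y` of a vertex, `crossing G g y` is the number of edges
dual to the hyperplane labelled by `y`, counted with signs, on any path of letters from `1` to `g`;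
equivalently it is the index, relative to that of `1`, of the sector of this hyperplane that
contains `g`. -/
noncomputable def crossing (g y : RAAG G) : ℤ := ((crossingHom G g).left y).toAdd

variable {G}

theorem crossing_mul (g h y : RAAG G) :
    crossing G (g * h) y = crossing G g y + crossing G h (g⁻¹ * y * g) := by
  simp only [crossing, map_mul, SemidirectProduct.mul_left, Pi.mul_apply, toAdd_mul,
    conjAut_apply, crossingHom_right]

@[simp]
theorem crossing_one (y : RAAG G) : crossing G 1 y = 0 := by
  simp [crossing]

open Classical in
theorem crossing_of (u : V) (y : RAAG G) :
    crossing G (of G u) y = if y = of G u then 1 else 0 := by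
  simp only [crossing, crossingHom_of, Pi.mulSingle_apply]
  split_ifs <;> rfl

theorem crossing_inv (g y : RAAG G) : crossing G g⁻¹ y = -crossing G g (g * y * g⁻¹) := by
  have h := crossing_mul g⁻¹ g y
  rw [inv_mul_cancel, crossing_one, inv_inv] at h
  omega

theorem crossing_conj (g a y : RAAG G) :
    crossing G (g * a * g⁻¹) y = crossing G g y + crossing G a (g⁻¹ * y * g) -
      crossing G g ((g * a * g⁻¹)⁻¹ * y * (g * a * g⁻¹)) := by
  rw [crossing_mul, crossing_mul, crossing_inv]
  have : g * ((g * a)⁻¹ * y * (g * a)) * g⁻¹ = (g * a * g⁻¹)⁻¹ * y * (g * a * g⁻¹) := by group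
  rw [this]
  ring

open Classical in
theorem crossing_mul_of (h : RAAG G) (u : V) (y : RAAG G) :
    crossing G (h * of G u) y = crossing G h y + if h * of G u * h⁻¹ = y then 1 else 0 := by
  rw [crossing_mul, crossing_of]
  congr 2
  rw [eq_iff_iff]
  constructor
  · intro e; rw [← e]; group
  · rintro rfl; group

open Classical in
theorem crossing_mul_of_inv (h : RAAG G) (u : V) (y : RAAG G) :
    crossing G (h * (of G u)⁻¹) y = crossing G h y - if h * of G u * h⁻¹ = y then 1 else 0 := by
  have e := crossing_mul_of (h * (of G u)⁻¹) u y
  have e2 : h * (of G u)⁻¹ * of G u * (h * (of G u)⁻¹)⁻¹ = h * of G u * h⁻¹ := by group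
  rw [e2, inv_mul_cancel_right] at e
  rw [e]
  ring

theorem finite_crossing_ne_zero (g : RAAG G) : {y | crossing G g y ≠ 0}.Finite := by
  classical
  induction g using induction_right with
  | one => simp
  | mul h u ih =>
    refine (ih.union (Set.finite_singleton (h * of G u * h⁻¹))).subset fun y hy => ?_
    by_contra hn
    simp only [Set.mem_union, Set.mem_ofPred_eq, Set.mem_singleton_iff, not_or, not_not] at hn
    exact hy (by rw [crossing_mul_of, if_neg (Ne.symm hn.2), hn.1, add_zero])
  | mul_inv h u ih =>
    refine (ih.union (Set.finite_singleton (h * of G u * h⁻¹))).subset fun y hy => ?_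
    by_contra hn
    simp only [Set.mem_union, Set.mem_ofPred_eq, Set.mem_singleton_iff, not_or, not_not] at hn
    exact hy (by rw [crossing_mul_of_inv, if_neg (Ne.symm hn.2), hn.1, sub_zero])

theorem conj_eq_of_commute {a y : RAAG G} (h : Commute a y) : a⁻¹ * y * a = y := by
  rw [mul_assoc, ← h.eq, inv_mul_cancel_left]

theorem crossing_zpow_of_commute {g y : RAAG G} (h : Commute g y) (n : ℤ) :
    crossing G (g ^ n) y = n * crossing G g y := by
  have hz (m : ℤ) : (g ^ m)⁻¹ * y * g ^ m = y := conj_eq_of_commute (h.zpow_left m)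
  induction n using Int.induction_on with
  | zero => simp
  | succ i ih => rw [zpow_add_one, crossing_mul, ih, hz]; ring
  | pred i ih =>
    have e := crossing_mul (g ^ (-(i : ℤ) - 1)) g y
    rw [hz, ← zpow_add_one, sub_add_cancel, ih] at e
    linarith

/-- A product of letters `u` crosses no hyperplane other than that of `u`. -/
theorem crossing_of_zpow_of_ne {u : V} {y : RAAG G} (h : y ≠ of G u) (n : ℤ) :
    crossing G (of G u ^ n) y = 0 := by
  have hz (m : ℤ) : of G u ^ m * of G u * (of G u ^ m)⁻¹ ≠ y := by
    rw [(Commute.self_zpow (of G u) m).symm.eq, mul_inv_cancel_right]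
    exact h.symm
  induction n using Int.induction_on with
  | zero => simp
  | succ i ih => rw [zpow_add_one, crossing_mul_of, ih, if_neg (hz _), add_zero]
  | pred i ih => rw [zpow_sub_one, crossing_mul_of_inv, ih, if_neg (hz _), sub_zero]

theorem crossing_of_zpow_self (u : V) (n : ℤ) : crossing G (of G u ^ n) (of G u) = n := by
  rw [crossing_zpow_of_commute (Commute.refl _), crossing_of, if_pos rfl, mul_one]

/-- A nonzero power of a generator has the same centralizer as the generator: compare the crossings
of the hyperplane of `u` by `u ^ n` and by its conjugate under `y`. -/
theorem commute_of_of_commute_zpow {u : V} {y : RAAG G} {n : ℤ} (hn : n ≠ 0)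
    (h : Commute y (of G u ^ n)) : Commute y (of G u) := by
  have e : y * of G u ^ n * y⁻¹ = of G u ^ n := by rw [h.eq, mul_inv_cancel_right]
  have e1 := crossing_conj y (of G u ^ n) (of G u)
  rw [e, crossing_of_zpow_self,
    conj_eq_of_commute (Commute.self_zpow (of G u) n).symm] at e1
  have e2 : crossing G (of G u ^ n) (y⁻¹ * of G u * y) = n := by omega
  by_contra hc
  refine hn (e2.symm.trans (crossing_of_zpow_of_ne (fun e3 => hc ?_) n))
  change y * of G u = of G u * y
  rw [mul_assoc, inv_mul_eq_iff_eq_mul] at e3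
  exact e3.symm

theorem commute_conj_iff {g a w : RAAG G} :
    Commute (g * a * g⁻¹) w ↔ Commute a (g⁻¹ * w * g) := by
  rw [commute_iff_eq, commute_iff_eq, ← mul_right_inj g⁻¹, ← mul_left_inj g]
  simp only [mul_assoc, inv_mul_cancel, inv_mul_cancel_left, mul_one]

/-- The analogue of `commute_of_of_commute_zpow` for conjugates of generators. -/
theorem commute_conj_of_commute_zpow {u : V} {g w : RAAG G} {n : ℤ} (hn : n ≠ 0)
    (h : Commute ((g * of G u * g⁻¹) ^ n) w) : Commute (g * of G u * g⁻¹) w := by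
  rw [conj_zpow, commute_conj_iff] at h
  exact commute_conj_iff.2 (commute_of_of_commute_zpow hn h.symm).symm

/-- By finiteness of the set of crossed hyperplanes, a hyperplane whose orbit under a cyclic group
consists of hyperplanes crossed by `c` has a finite orbit. -/
theorem exists_commute_zpow {a c w : RAAG G}
    (h : ∀ n : ℤ, crossing G c ((a ^ n)⁻¹ * w * a ^ n) ≠ 0) :
    ∃ n : ℤ, n ≠ 0 ∧ Commute (a ^ n) w := by
  by_contra hcon
  push Not at hcon
  have inj : Function.Injective fun n : ℤ => (a ^ n)⁻¹ * w * a ^ n := by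
    intro m n e
    by_contra hmn
    refine hcon (n - m) (sub_ne_zero.2 (Ne.symm hmn)) ?_
    have e' : (a ^ m)⁻¹ * w * a ^ m = (a ^ n)⁻¹ * w * a ^ n := e
    change a ^ (n - m) * w = w * a ^ (n - m)
    have e1 : a ^ (n - m) = a ^ n * (a ^ m)⁻¹ := zpow_sub a n m
    rw [e1]
    calc a ^ n * (a ^ m)⁻¹ * w = a ^ n * ((a ^ m)⁻¹ * w * a ^ m) * (a ^ m)⁻¹ := by group
      _ = w * (a ^ n * (a ^ m)⁻¹) := by rw [e']; group
  exact Set.infinite_of_injective_forall_mem inj h (finite_crossing_ne_zero c)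

/-- The crossings of an element commuting with `u` are invariant under conjugation by `u`: expand
`u * c = c * u`. -/
theorem crossing_conj_arg {c : RAAG G} {u : V} (h : Commute c (of G u)) (y : RAAG G) :
    crossing G c ((of G u)⁻¹ * y * of G u) = crossing G c y := by
  have e := crossing_mul (of G u) c y
  have e2 := crossing_mul c (of G u) y
  have e3 : crossing G (of G u) (c⁻¹ * y * c) = crossing G (of G u) y := by
    rw [crossing_of, crossing_of]
    congr 1
    rw [eq_iff_iff, mul_assoc, inv_mul_eq_iff_eq_mul, h.eq, mul_left_inj]
  rw [h.eq] at e2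
  omega

/-- The hyperplanes separating `1` from an element of the centralizer of `u` commute with `u`. -/
theorem commute_of_crossing_ne_zero {c w : RAAG G} {u : V} (h : Commute c (of G u))
    (hw : crossing G c w ≠ 0) : Commute w (of G u) := by
  have hz (n : ℤ) : crossing G c ((of G u ^ n)⁻¹ * w * of G u ^ n) = crossing G c w := by
    induction n using Int.induction_on with
    | zero => simp
    | succ i ih =>
      rw [← ih, ← crossing_conj_arg h ((of G u ^ (i : ℤ))⁻¹ * w * of G u ^ (i : ℤ))]
      congr 1
      group
    | pred i ih =>
      rw [← ih, ← crossing_conj_arg h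
        ((of G u ^ (-(i : ℤ) - 1))⁻¹ * w * of G u ^ (-(i : ℤ) - 1))]
      congr 1
      group
  obtain ⟨n, hn, hc⟩ := exists_commute_zpow (a := of G u) (c := c) (w := w)
    fun n => by rw [hz]; exact hw
  exact commute_of_of_commute_zpow hn hc.symm

theorem crossing_conj_of_commute {u : V} {g y : RAAG G} (h : Commute (g * of G u * g⁻¹) y)
    (hne : y ≠ g * of G u * g⁻¹) : crossing G (g * of G u * g⁻¹) y = 0 := by
  rw [crossing_conj, conj_eq_of_commute h, crossing_of, if_neg]
  · ring
  · intro e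
    exact hne (by rw [← e]; group)

theorem crossing_conj_self (u : V) (g : RAAG G) :
    crossing G (g * of G u * g⁻¹) (g * of G u * g⁻¹) = 1 := by
  rw [crossing_conj, conj_eq_of_commute (Commute.refl _), crossing_of, if_pos (by group)]
  ring

/-- All the endpoints of edges dual to the hyperplane of `f * u * f⁻¹` lie in the same sector of
the hyperplane of an element `y` that does not commute with `f * u * f⁻¹`. -/
theorem crossing_eq_of_conj_eq {u v : V} {f h y : RAAG G}
    (hy : ¬ Commute (f * of G u * f⁻¹) y)
    (e : h * of G v * h⁻¹ = f * of G u * f⁻¹) : crossing G h y = crossing G f y := by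
  obtain rfl := eq_of_conj_eq e
  have hc : Commute (f⁻¹ * h) (of G v) := by
    change f⁻¹ * h * of G v = of G v * (f⁻¹ * h)
    calc f⁻¹ * h * of G v = f⁻¹ * (h * of G v * h⁻¹) * h := by group
      _ = of G v * (f⁻¹ * h) := by rw [e]; group
  have h0 : crossing G (f⁻¹ * h) (f⁻¹ * y * f) = 0 := by
    by_contra h1
    exact hy (commute_conj_iff.2 (commute_of_crossing_ne_zero hc h1).symm)
  have h2 := crossing_mul f (f⁻¹ * h) y
  rw [mul_inv_cancel_left, h0, add_zero] at h2
  exact h2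

/-- Two hyperplanes that are not transverse: one sector of the first contains all of the second and
conversely, and every vertex lies in one of these two sectors. For the proof, follow a path from an
edge of the second hyperplane: the alternative can only change along an edge dual to one of the two
hyperplanes, and there it holds at both ends. -/
theorem crossing_eq_or_crossing_eq {u v : V} {f g : RAAG G}
    (hxy : ¬ Commute (f * of G u * f⁻¹) (g * of G v * g⁻¹)) (h : RAAG G) :
    crossing G h (f * of G u * f⁻¹) = crossing G g (f * of G u * f⁻¹) ∨
      crossing G h (g * of G v * g⁻¹) = crossing G f (g * of G v * g⁻¹) := by
  set x := f * of G u * f⁻¹ with hx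
  set y := g * of G v * g⁻¹ with hy
  have hX (k : RAAG G) (w : V) (e : k * of G w * k⁻¹ = x) : crossing G k y = crossing G f y :=
    crossing_eq_of_conj_eq hxy e
  have hY (k : RAAG G) (w : V) (e : k * of G w * k⁻¹ = y) : crossing G k x = crossing G g x :=
    crossing_eq_of_conj_eq (fun h => hxy h.symm) e
  have hne : x ≠ y := fun e => hxy (e ▸ Commute.refl x)
  obtain ⟨k, rfl⟩ : ∃ k, h = g * k := ⟨g⁻¹ * h, by group⟩
  induction k using induction_right with
  | one => left; rw [mul_one]
  | mul k w ih =>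
    rw [← mul_assoc, crossing_mul_of, crossing_mul_of]
    by_cases h1 : g * k * of G w * (g * k)⁻¹ = x
    · right; rw [if_neg (h1.trans_ne hne), hX _ _ h1, add_zero]
    by_cases h2 : g * k * of G w * (g * k)⁻¹ = y
    · left; rw [if_neg h1, hY _ _ h2, add_zero]
    rw [if_neg h1, if_neg h2, add_zero, add_zero]
    exact ih
  | mul_inv k w ih =>
    rw [← mul_assoc, crossing_mul_of_inv, crossing_mul_of_inv]
    by_cases h1 : g * k * of G w * (g * k)⁻¹ = x
    · right; rw [if_neg (h1.trans_ne hne), hX _ _ h1, sub_zero]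
    by_cases h2 : g * k * of G w * (g * k)⁻¹ = y
    · left; rw [if_neg h1, hY _ _ h2, sub_zero]
    rw [if_neg h1, if_neg h2, sub_zero, sub_zero]
    exact ih

end Crossing


/-! ### Syllable length -/

section Syllables

variable {S : Type*} (Λ : SimpleGraph S)

theorem exists_prod_zpow_eq (x : RAAG Λ) :
    ∃ L : List (S × ℤ), (L.map fun p => of Λ p.1 ^ p.2).prod = x := by
  induction x using induction_right with
  | one => exact ⟨[], rfl⟩
  | mul h u ih => obtain ⟨L, rfl⟩ := ih; exact ⟨L ++ [(u, 1)], by simp⟩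
  | mul_inv h u ih => obtain ⟨L, rfl⟩ := ih; exact ⟨L ++ [(u, -1)], by simp⟩

theorem exists_length_eq (x : RAAG Λ) :
    ∃ n : ℕ, ∃ L : List (S × ℤ), L.length = n ∧ (L.map fun p => of Λ p.1 ^ p.2).prod = x := by
  obtain ⟨L, hL⟩ := exists_prod_zpow_eq Λ x
  exact ⟨_, L, rfl, hL⟩

open Classical in
/-- The syllable length: the least number of powers of vertices whose product is `x`. -/
noncomputable def syllableLength (x : RAAG Λ) : ℕ := Nat.find (exists_length_eq Λ x)

variable {Λ}

theorem syllableLength_zpow_mul_le (j : S) (n : ℤ) (x : RAAG Λ) :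
    syllableLength Λ (of Λ j ^ n * x) ≤ syllableLength Λ x + 1 := by
  classical
  obtain ⟨L, hL, hx⟩ := Nat.find_spec (exists_length_eq Λ x)
  refine Nat.find_min' _ ⟨(j, n) :: L, ?_, ?_⟩
  · rw [List.length_cons, hL]; rfl
  · rw [List.map_cons, List.prod_cons, hx]

theorem exists_eq_zpow_mul_of_ne_one {x : RAAG Λ} (hx : x ≠ 1) :
    ∃ (j : S) (n : ℤ) (y : RAAG Λ), x = of Λ j ^ n * y ∧
      syllableLength Λ y < syllableLength Λ x := by
  classical
  obtain ⟨L, hL, hp⟩ := Nat.find_spec (exists_length_eq Λ x)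
  cases L with
  | nil => exact absurd hp.symm hx
  | cons p L =>
    refine ⟨p.1, p.2, (L.map fun p => of Λ p.1 ^ p.2).prod, ?_, ?_⟩
    · rw [← hp, List.map_cons, List.prod_cons]
    · have h1 : syllableLength Λ (L.map fun p => of Λ p.1 ^ p.2).prod ≤ L.length :=
        Nat.find_min' _ ⟨L, rfl, rfl⟩
      have h2 : L.length + 1 = syllableLength Λ x := hL
      omega

end Syllables

/-! ### Ping-pong for right-angled Artin groups -/

section PingPong

variable {S : Type*} {Λ : SimpleGraph S} {H : Type*} [Group H]

/-- The data for the ping-pong argument: each vertex `j` of `Λ` comes with a map `s j` from the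
group `H` to the set `ℤ` of sectors of the hyperplane of `j`, and with a set `F j` of sectors that
contains the sector of `1` and those in which the hyperplanes not transverse to that of `j` lie. The
image of `j` in `H` shifts the sectors of `j` by `N`, and the translates of `F j` by distinct
multiples of `N` are disjoint. -/
structure PingPong (f : RAAG Λ →* H) (s : S → H → ℤ) (F : S → Set ℤ) (N : ℤ) : Prop where
  shift : ∀ j (n : ℤ) h, s j (f (of Λ j ^ n) * h) = s j h + N * n
  fix : ∀ j k, Λ.Adj j k → ∀ (n : ℤ) h, s j (f (of Λ k ^ n) * h) = s j h
  sectors : ∀ j k, j ≠ k → ¬ Λ.Adj j k → ∀ h, s j h ∈ F j ∨ s k h ∈ F k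
  base : ∀ j, s j 1 ∈ F j
  disjoint : ∀ j, ∀ a ∈ F j, ∀ n : ℤ, a + N * n ∈ F j → n = 0

variable {f : RAAG Λ →* H} {s : S → H → ℤ} {F : S → Set ℤ} {N : ℤ}

/-- The ping-pong lemma: `x` moves `1` to the sectors of `j` prescribed by the exponent `n` of the
largest power of `j` that can be split off on the left of `x`. -/
theorem PingPong.exists_head (hP : PingPong f s F N) (x : RAAG Λ) (j : S) :
    ∃ (n : ℤ) (y : RAAG Λ), x = of Λ j ^ n * y ∧
      (n ≠ 0 → syllableLength Λ y < syllableLength Λ x) ∧ ∃ a ∈ F j, s j (f x) = a + N * n := by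
  induction hm : syllableLength Λ x using Nat.strong_induction_on generalizing x j with
  | _ m ih =>
  subst hm
  have split (k : S) (n : ℤ) (y : RAAG Λ) (hx : x = of Λ k ^ n * y)
      (hy : syllableLength Λ y < syllableLength Λ x) : s k (f y) ∈ F k := by
    obtain ⟨n', z, hz, hlt, a, ha, hs⟩ := ih _ hy y k rfl
    by_cases hn' : n' = 0
    · rw [hs, hn', mul_zero, add_zero]; exact ha
    · have h1 := hlt hn'
      have h2 := syllableLength_zpow_mul_le k (n + n') z
      rw [zpow_add, mul_assoc, ← hz, ← hx] at h2
      omega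
  have shift (k : S) (n : ℤ) (y : RAAG Λ) (hx : x = of Λ k ^ n * y) :
      s k (f x) = s k (f y) + N * n := by rw [hx, map_mul, hP.shift]
  by_cases hhead : ∃ (n : ℤ) (y : RAAG Λ), x = of Λ j ^ n * y ∧
      syllableLength Λ y < syllableLength Λ x
  · obtain ⟨n, y, hx, hy⟩ := hhead
    exact ⟨n, y, hx, fun _ => hy, _, split j n y hx hy, shift j n y hx⟩
  suffices h : s j (f x) ∈ F j from
    ⟨0, x, by simp, fun h => absurd rfl h, _, h, by simp⟩
  by_cases hx1 : x = 1
  · rw [hx1, map_one]; exact hP.base j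
  obtain ⟨k, n, y, hx, hy⟩ := exists_eq_zpow_mul_of_ne_one hx1
  have hn : n ≠ 0 := by
    rintro rfl
    rw [zpow_zero, one_mul] at hx
    rw [hx] at hy
    exact lt_irrefl _ hy
  have hjk : j ≠ k := by
    rintro rfl
    exact hhead ⟨n, y, hx, hy⟩
  by_cases hadj : Λ.Adj j k
  · -- `k` fixes the sectors of `j`, and `y` cannot start with `j` since `x` does not
    obtain ⟨n', z, hz, hlt, a, ha, hs⟩ := ih _ hy y j rfl
    have hfix : s j (f x) = s j (f y) := by rw [hx, map_mul, hP.fix j k hadj]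
    by_cases hn' : n' = 0
    · rw [hfix, hs, hn', mul_zero, add_zero]; exact ha
    · refine absurd ⟨n', of Λ k ^ n * z, ?_, ?_⟩ hhead
      · rw [hx, hz, ← mul_assoc, ← mul_assoc,
          (((commute_of_of_adj hadj).zpow_zpow n' n).eq)]
      · have h1 := hlt hn'
        have h2 := syllableLength_zpow_mul_le k n z
        omega
  · -- `f x` lies outside the sectors in `F k`, hence in the sector of `j` containing `k`
    refine (hP.sectors j k hjk hadj (f x)).resolve_right fun hk => hn ?_
    rw [shift k n y hx] at hk
    exact hP.disjoint k _ (split k n y hx hy) n hk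

/-- A nontrivial element moves `1` out of the sectors `F j` of some vertex `j`. -/
theorem PingPong.exists_ne_zero (hP : PingPong f s F N) {x : RAAG Λ} (hx : x ≠ 1) :
    ∃ (j : S) (n : ℤ) (y : RAAG Λ), n ≠ 0 ∧ x = of Λ j ^ n * y ∧
      syllableLength Λ y < syllableLength Λ x ∧ ∃ a ∈ F j, s j (f x) = a + N * n := by
  obtain ⟨j, m, z, hz, hlt⟩ := exists_eq_zpow_mul_of_ne_one hx
  obtain ⟨n, y, hy, hly, a, ha, hs⟩ := hP.exists_head x j
  by_cases hn : n = 0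
  · exfalso
    obtain ⟨n', w, hw, hlw, b, hb, hsb⟩ := hP.exists_head z j
    by_cases hn' : n' = 0
    · -- then `s j (f z)` and `s j (f x)` both lie in `F j`, which forces `m = 0`
      have e : s j (f x) = s j (f z) + N * m := by rw [hz, map_mul, hP.shift]
      have hm : m = 0 := by
        refine hP.disjoint j b hb m ?_
        rw [hsb, hs, hn, hn'] at e
        have e2 : b + N * m = a := by linarith
        rw [e2]; exact ha
      rw [hm, zpow_zero, one_mul] at hz
      rw [hz] at hlt
      exact lt_irrefl _ hlt
    · have h1 := hlw hn'
      have h2 := syllableLength_zpow_mul_le j (m + n') w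
      rw [zpow_add, mul_assoc, ← hw, ← hz] at h2
      omega
  · exact ⟨j, n, y, hn, hy, hly hn, a, ha, hs⟩

theorem PingPong.injective (hP : PingPong f s F N) : Function.Injective f := by
  rw [injective_iff_map_eq_one]
  intro x hx
  by_contra hne
  obtain ⟨j, n, y, hn, -, -, a, ha, hs⟩ := hP.exists_ne_zero hne
  rw [hx] at hs
  exact hn (hP.disjoint j a ha n (hs ▸ hP.base j))

end PingPong

/-! ### Ping-pong of a right-angled Artin group on itself -/

section SelfPingPong

variable {V : Type*} {G : SimpleGraph V}

theorem crossing_zpow_mul_of_commute {a y : RAAG G} (h : Commute a y) (n : ℤ) (g : RAAG G) :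
    crossing G (a ^ n * g) y = n * crossing G a y + crossing G g y := by
  rw [crossing_mul, crossing_zpow_of_commute h, conj_eq_of_commute (h.zpow_left n)]

/-- `A(G)` plays ping-pong on itself, with the hyperplanes of its generators. -/
theorem pingPong_id :
    PingPong (MonoidHom.id (RAAG G)) (fun u g => crossing G g (of G u)) (fun _ => {0}) 1 where
  shift u n h := by
    rw [MonoidHom.id_apply, crossing_zpow_mul_of_commute (Commute.refl _), crossing_of,
      if_pos rfl]
    ring
  fix u v huv n h := by
    rw [MonoidHom.id_apply, crossing_zpow_mul_of_commute (commute_of_of_adj huv).symm, crossing_of,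
      if_neg fun e => huv.ne (of_injective e)]
    ring
  sectors u v huv hadj h := by
    have hc : ¬ Commute (1 * of G u * 1⁻¹) (1 * of G v * 1⁻¹) := by
      simpa using fun hc => hadj (adj_of_commute huv hc)
    simpa using crossing_eq_or_crossing_eq hc h
  base u := crossing_one _
  disjoint u a ha n h := by
    rw [Set.mem_singleton_iff] at ha h
    omega

end SelfPingPong

/-! ### Centralizers of vertices -/

section Hyperplanes

variable {V : Type*} {G : SimpleGraph V}

/-- Every nontrivial `x` is `w ^ k * y` with `y` shorter, where `k` is the number of crossings of
the hyperplane of `w`. -/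
theorem exists_eq_zpow_mul_crossing {x : RAAG G} (hx : x ≠ 1) :
    ∃ (w : V) (k : ℤ) (y : RAAG G), k ≠ 0 ∧ x = of G w ^ k * y ∧
      syllableLength G y < syllableLength G x ∧ crossing G x (of G w) = k := by
  obtain ⟨w, k, y, hk, hxy, hlt, a, ha, hs⟩ := pingPong_id.exists_ne_zero hx
  refine ⟨w, k, y, hk, hxy, hlt, ?_⟩
  rw [Set.mem_singleton_iff] at ha
  rw [MonoidHom.id_apply] at hs
  omega

/-- The centralizer of a vertex is generated by the vertices that commute with it; this is stated
as an induction principle. -/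
theorem centralizer_induction {u : V} {p : RAAG G → Prop} (one : p 1)
    (mul : ∀ (w : V) (k : ℤ) (c : RAAG G), k ≠ 0 → Commute (of G w) (of G u) → p c →
      p (of G w ^ k * c)) {c : RAAG G} (hc : Commute c (of G u)) : p c := by
  induction hm : syllableLength G c using Nat.strong_induction_on generalizing c with
  | _ m ih =>
  subst hm
  by_cases h1 : c = 1
  · rw [h1]; exact one
  obtain ⟨w, k, y, hk, hxy, hlt, hcr⟩ := exists_eq_zpow_mul_crossing h1
  have hw : Commute (of G w) (of G u) := commute_of_crossing_ne_zero hc (by rw [hcr]; exact hk)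
  have hy : Commute y (of G u) := by
    have : y = (of G w ^ k)⁻¹ * c := by rw [hxy, inv_mul_cancel_left]
    rw [this]
    exact (hw.zpow_left k).inv_left.mul_left hc
  rw [hxy]
  exact mul w k y hk hw (ih _ hlt hy rfl)

/-- A conjugate of a vertex that commutes with the vertex `u` is conjugate to a vertex commuting
with `u` by an element of the centralizer of `u`. -/
theorem exists_conj_of_commute {u v : V} {h : RAAG G}
    (hc : Commute (h * of G v * h⁻¹) (of G u)) :
    ∃ c : RAAG G, Commute c (of G u) ∧ Commute (of G v) (of G u) ∧
      h * of G v * h⁻¹ = c * of G v * c⁻¹ := by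
  induction hm : syllableLength G h using Nat.strong_induction_on generalizing h with
  | _ m ih =>
  subst hm
  by_cases h1 : h = 1
  · subst h1
    exact ⟨1, Commute.one_left _, by simpa using hc, rfl⟩
  obtain ⟨w, k, g, hk, rfl, hlt, hcr⟩ := exists_eq_zpow_mul_crossing h1
  set h := of G w ^ k * g with hh
  set y := h * of G v * h⁻¹ with hy
  have hconj : g * of G v * g⁻¹ = (of G w ^ k)⁻¹ * y * of G w ^ k := by
    rw [hy, hh]; group
  by_cases hwu : Commute (of G w) (of G u)
  · -- the first syllable of `h` belongs to the centralizer of `u`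
    have hwk := hwu.zpow_left k
    obtain ⟨c, hcu, hvu, e⟩ := ih _ hlt
      (by rw [hconj]; exact (hwk.inv_left.mul_left hc).mul_left hwk) rfl
    refine ⟨of G w ^ k * c, hwk.mul_left hcu, hvu, ?_⟩
    calc y = of G w ^ k * (g * of G v * g⁻¹) * (of G w ^ k)⁻¹ := by rw [hconj]; group
      _ = _ := by rw [e]; group
  · -- the first syllable of `h` commutes with `y`, so it can be dropped
    have hwy : Commute y (of G w) := by
      have horb (n : ℤ) : crossing G h ((y ^ n)⁻¹ * of G w * y ^ n) ≠ 0 := by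
        have h0 : crossing G (y ^ n) (of G w) = 0 := by
          by_contra hne
          exact hwu (commute_of_crossing_ne_zero (hc.zpow_left n) hne)
        have hne : h⁻¹ * of G w * h ≠ of G v := by
          intro e
          apply hwu
          have : of G w = y := by rw [hy, ← e]; group
          rw [this]; exact hc
        rw [hy, conj_zpow, crossing_conj, crossing_of_zpow_of_ne hne, hcr, ← conj_zpow, ← hy] at h0
        omega
      obtain ⟨n, hn, hcn⟩ := exists_commute_zpow horb
      exact commute_conj_of_commute_zpow hn hcn
    have e : g * of G v * g⁻¹ = y := by
      rw [hconj]
      exact conj_eq_of_commute (hwy.zpow_right k).symm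
    obtain ⟨c, hcu, hvu, e'⟩ := ih _ hlt (by rw [e]; exact hc) rfl
    exact ⟨c, hcu, hvu, e ▸ e'⟩

/-! ### Labels of edges -/

theorem qmGraph_adj {a b : RAAG G} :
    (qmGraph G).Adj a b ↔ ∃ (u : V) (k : ℤ), k ≠ 0 ∧ b = a * of G u ^ k := by
  rw [qmGraph, SimpleGraph.mulCayley_adj']
  constructor
  · rintro ⟨-, g, ⟨u, k, hk, rfl⟩, h | h⟩
    · exact ⟨u, k, hk, h.symm⟩
    · exact ⟨u, -k, neg_ne_zero.2 hk, by rw [h, zpow_neg, mul_inv_cancel_right]⟩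
  · rintro ⟨u, k, hk, rfl⟩
    refine ⟨fun h => of_zpow_ne_one (G := G) u hk ?_, _, ⟨u, k, hk, rfl⟩, Or.inl rfl⟩
    exact (left_eq_mul.1 h)

theorem qmGraph_adj_mul_zpow (g : RAAG G) (u : V) {k : ℤ} (hk : k ≠ 0) :
    (qmGraph G).Adj g (g * of G u ^ k) :=
  qmGraph_adj.2 ⟨u, k, hk, rfl⟩

theorem eq_of_zpow_eq_zpow {u v : V} {k l : ℤ} (hk : k ≠ 0) (h : of G u ^ k = of G v ^ l) :
    u = v := by
  classical
  have h1 := toAdd_expSum_of_zpow (G := G) u u k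
  have h2 := toAdd_expSum_of_zpow (G := G) u v l
  rw [h, h2, if_pos rfl] at h1
  by_contra hne
  rw [if_neg (Ne.symm hne)] at h1
  exact hk h1.symm

/-- `x` labels the edge `e` of `QM(G)`: `e = {g, g * u ^ k}` and `x = g * u * g⁻¹`. -/
def IsLabel (e : Sym2 (RAAG G)) (x : RAAG G) : Prop :=
  ∃ (g : RAAG G) (u : V) (k : ℤ), k ≠ 0 ∧ e = s(g, g * of G u ^ k) ∧ x = g * of G u * g⁻¹

theorem conj_mul_zpow (g : RAAG G) (u : V) (k : ℤ) :
    g * of G u ^ k * of G u * (g * of G u ^ k)⁻¹ = g * of G u * g⁻¹ := by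
  have := (Commute.self_zpow (of G u) k).eq
  rw [mul_assoc g, ← this]
  group

theorem isLabel_mk {a b x : RAAG G} : IsLabel s(a, b) x ↔
    ∃ (u : V) (k : ℤ), k ≠ 0 ∧ b = a * of G u ^ k ∧ x = a * of G u * a⁻¹ := by
  constructor
  · rintro ⟨g, u, k, hk, e, rfl⟩
    rw [Sym2.eq_iff] at e
    rcases e with ⟨rfl, rfl⟩ | ⟨rfl, rfl⟩
    · exact ⟨u, k, hk, rfl, rfl⟩
    · exact ⟨u, -k, neg_ne_zero.2 hk, by rw [zpow_neg, mul_inv_cancel_right],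
        (conj_mul_zpow _ _ _).symm⟩
  · rintro ⟨u, k, hk, rfl, rfl⟩
    exact ⟨a, u, k, hk, rfl, rfl⟩

theorem IsLabel.unique {e : Sym2 (RAAG G)} {x y : RAAG G} (hx : IsLabel e x) (hy : IsLabel e y) :
    x = y := by
  induction e with
  | _ a b =>
  obtain ⟨u, k, hk, rfl, rfl⟩ := isLabel_mk.1 hx
  obtain ⟨v, l, hl, e, rfl⟩ := isLabel_mk.1 hy
  rw [eq_of_zpow_eq_zpow hk (mul_left_cancel e)]

theorem exists_isLabel {e : Sym2 (RAAG G)} (he : e ∈ (qmGraph G).edgeSet) : ∃ x, IsLabel e x := by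
  induction e with
  | _ a b =>
  obtain ⟨u, k, hk, e⟩ := qmGraph_adj.1 he
  exact ⟨_, a, u, k, hk, congrArg (fun c => s(a, c)) e, rfl⟩

/-- A `4`-cycle of `QM(G)` either lies in a coset of a cyclic subgroup `⟨u⟩`, or is the product of
two edges labelled by powers of commuting vertices; in both cases opposite edges carry powers of
the same vertex. -/
theorem square_labels {u v w x : V} {p q r t : ℤ} (hp : p ≠ 0) (hq : q ≠ 0) (hr : r ≠ 0)
    (ht : t ≠ 0) (h : of G u ^ p * of G v ^ q * of G w ^ r * of G x ^ t = 1)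
    (huv : of G u ^ p * of G v ^ q ≠ 1) (hvw : of G v ^ q * of G w ^ r ≠ 1) :
    u = w ∧ v = x ∧ Commute (of G u) (of G v) := by
  classical
  have hsum (y : V) : (if u = y then p else 0) + (if v = y then q else 0) +
      (if w = y then r else 0) + (if x = y then t else 0) = 0 := by
    have := congrArg (fun z => (expSum G y z).toAdd) h
    simpa only [map_mul, toAdd_mul, toAdd_expSum_of_zpow, map_one, toAdd_one] using this
  have huv' : u = v → p + q ≠ 0 := by
    rintro rfl e
    exact huv (by rw [← zpow_add, e, zpow_zero])
  have hvw' : v = w → q + r ≠ 0 := by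
    rintro rfl e
    exact hvw (by rw [← zpow_add, e, zpow_zero])
  have h1 := hsum u
  have h2 := hsum v
  have h3 := hsum w
  have h4 := hsum x
  have huw : u = w := by
    by_contra hne
    grind
  have hvx : v = x := by
    by_contra hne
    grind
  subst huw hvx
  refine ⟨rfl, rfl, ?_⟩
  by_cases huv0 : u = v
  · rw [huv0]
  have e1 : r = -p := by grind
  have e2 : t = -q := by grind
  subst e1 e2
  have hcomm : Commute (of G u ^ p) (of G v ^ q) := by
    rw [zpow_neg, zpow_neg, mul_inv_eq_one, mul_inv_eq_iff_eq_mul] at h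
    exact h
  have hc1 := commute_of_of_commute_zpow hq hcomm
  exact (commute_of_of_commute_zpow hp hc1.symm).symm

theorem IsFourCycle.exists_labels {a b c d : RAAG G} (h : IsFourCycle (qmGraph G) a b c d) :
    ∃ (u v : V) (p q : ℤ), p ≠ 0 ∧ q ≠ 0 ∧ Commute (of G u) (of G v) ∧ b = a * of G u ^ p ∧
      c = b * of G v ^ q ∧ (∃ r : ℤ, r ≠ 0 ∧ d = c * of G u ^ r) ∧
      ∃ t : ℤ, t ≠ 0 ∧ a = d * of G v ^ t := by
  obtain ⟨hab, hbc, hcd, hda, hac, hbd⟩ := h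
  obtain ⟨u, p, hp, rfl⟩ := qmGraph_adj.1 hab
  obtain ⟨v, q, hq, rfl⟩ := qmGraph_adj.1 hbc
  obtain ⟨w, r, hr, rfl⟩ := qmGraph_adj.1 hcd
  obtain ⟨x, t, ht, e⟩ := qmGraph_adj.1 hda
  obtain ⟨rfl, rfl, hc⟩ := square_labels (G := G) hp hq hr ht
    (by simp only [mul_assoc] at e ⊢; exact left_eq_mul.1 e)
    (fun e' => hac (by rw [mul_assoc, e', mul_one]))
    (fun e' => hbd (by rw [mul_assoc (a * of G u ^ p), e', mul_one]))
  exact ⟨u, v, p, q, hp, hq, hc, rfl, rfl, ⟨r, hr, rfl⟩, t, ht, e⟩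

theorem conj_mul_zpow_of_commute {u v : V} (h : Commute (of G u) (of G v)) (g : RAAG G) (k : ℤ) :
    g * of G u ^ k * of G v * (g * of G u ^ k)⁻¹ = g * of G v * g⁻¹ := by
  rw [mul_assoc g, (h.zpow_left k).eq]
  group

theorem isLabel_of_edgeStep {e₁ e₂ : (qmGraph G).edgeSet} (h : EdgeStep (qmGraph G) e₁ e₂)
    {x : RAAG G} (hx : IsLabel e₁.1 x) : IsLabel e₂.1 x := by
  cases h with
  | triangle a b c hab hac hbc =>
    obtain ⟨u, k, hk, rfl, rfl⟩ := isLabel_mk.1 hx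
    obtain ⟨v, l, hl, rfl⟩ := qmGraph_adj.1 hac
    obtain ⟨w, m, hm, e⟩ := qmGraph_adj.1 hbc
    have huv : u = v := by
      classical
      by_contra hne
      rw [mul_assoc, mul_right_inj] at e
      have hsum (y : V) := congrArg (fun z => (expSum G y z).toAdd) e
      simp only [map_mul, toAdd_mul, toAdd_expSum_of_zpow] at hsum
      have h1 := hsum u
      have h2 := hsum v
      grind
    subst huv
    exact isLabel_mk.2 ⟨u, l, hl, rfl, rfl⟩
  | square a b c d h =>
    obtain ⟨u, v, p, q, hp, hq, hc, rfl, rfl, ⟨r, hr, rfl⟩, -⟩ := IsFourCycle.exists_labels h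
    have hx' : IsLabel s(a, a * of G u ^ p) (a * of G u * a⁻¹) := isLabel_mk.2 ⟨u, p, hp, rfl, rfl⟩
    rw [hx.unique hx']
    refine isLabel_mk.2 ⟨u, r, hr, rfl, ?_⟩
    rw [conj_mul_zpow_of_commute hc.symm, conj_mul_zpow]

theorem isLabel_of_edgeStep_symm {e₁ e₂ : (qmGraph G).edgeSet} (h : EdgeStep (qmGraph G) e₁ e₂)
    {x : RAAG G} (hx : IsLabel e₂.1 x) : IsLabel e₁.1 x := by
  obtain ⟨y, hy⟩ := exists_isLabel e₁.2
  rw [hx.unique (isLabel_of_edgeStep h hy)]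
  exact hy

theorem isLabel_iff_of_eqvGen {e₁ e₂ : (qmGraph G).edgeSet}
    (h : Relation.EqvGen (EdgeStep (qmGraph G)) e₁ e₂) (x : RAAG G) :
    IsLabel e₁.1 x ↔ IsLabel e₂.1 x := by
  induction h with
  | rel _ _ h => exact ⟨isLabel_of_edgeStep h, isLabel_of_edgeStep_symm h⟩
  | refl => rfl
  | symm _ _ _ ih => exact ih.symm
  | trans _ _ _ _ _ ih₁ ih₂ => exact ih₁.trans ih₂

/-! ### Hyperplanes and their labels -/

/-- The common label of the edges of a hyperplane. -/
noncomputable def hyperplaneLabel : Hyperplane (qmGraph G) → RAAG G :=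
  Quotient.lift (fun e => (exists_isLabel e.2).choose) fun e₁ e₂ h =>
    (exists_isLabel e₁.2).choose_spec.unique
      ((isLabel_iff_of_eqvGen h _).2 (exists_isLabel e₂.2).choose_spec)

theorem hyperplaneLabel_eq {J : Hyperplane (qmGraph G)} {e : Sym2 (RAAG G)} (hJ : J.Contains e)
    {x : RAAG G} (hx : IsLabel e x) : hyperplaneLabel J = x := by
  obtain ⟨he, rfl⟩ := hJ
  exact (exists_isLabel he).choose_spec.unique hx

/-- The hyperplane dual to the edge `{g, g * u}`. -/
def dual (g : RAAG G) (u : V) : Hyperplane (qmGraph G) :=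
  Quotient.mk _ ⟨s(g, g * of G u ^ (1 : ℤ)), qmGraph_adj_mul_zpow g u one_ne_zero⟩

theorem dual_contains (g : RAAG G) (u : V) {k : ℤ} (hk : k ≠ 0) :
    (dual g u).Contains s(g, g * of G u ^ k) := by
  refine ⟨qmGraph_adj_mul_zpow g u hk, ?_⟩
  by_cases h1 : k = 1
  · subst h1; rfl
  · refine Quotient.sound (Relation.EqvGen.rel _ _
      (EdgeStep.triangle _ _ _ _ _ ?_))
    refine qmGraph_adj.2 ⟨u, 1 - k, by omega, ?_⟩
    rw [mul_assoc, ← zpow_add, add_sub_cancel]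

theorem eq_of_contains {X : Type*} {Y : SimpleGraph X} {J K : Hyperplane Y} {e : Sym2 X}
    (hJ : J.Contains e) (hK : K.Contains e) : J = K := by
  obtain ⟨_, rfl⟩ := hJ
  obtain ⟨_, rfl⟩ := hK
  rfl

theorem dual_mul_zpow_self (g : RAAG G) (u : V) {k : ℤ} (hk : k ≠ 0) :
    dual (g * of G u ^ k) u = dual g u := by
  have h1 := dual_contains (g * of G u ^ k) u (neg_ne_zero.2 hk)
  rw [zpow_neg, mul_inv_cancel_right, Sym2.eq_swap] at h1
  exact eq_of_contains h1 (dual_contains g u hk)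

theorem isFourCycle_of_commute {u w : V} (hne : u ≠ w) (h : Commute (of G u) (of G w))
    (g : RAAG G) {p q : ℤ} (hp : p ≠ 0) (hq : q ≠ 0) :
    IsFourCycle (qmGraph G) g (g * of G u ^ p) (g * of G u ^ p * of G w ^ q) (g * of G w ^ q) where
  adj_ab := qmGraph_adj_mul_zpow _ _ hp
  adj_bc := qmGraph_adj_mul_zpow _ _ hq
  adj_cd := by
    rw [mul_assoc, (h.zpow_zpow p q).eq, ← mul_assoc]
    exact (qmGraph_adj_mul_zpow _ _ hp).symm
  adj_da := (qmGraph_adj_mul_zpow _ _ hq).symm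
  ne_ac := by
    intro e
    rw [mul_assoc] at e
    have e' := eq_inv_of_mul_eq_one_left (left_eq_mul.1 e)
    rw [← zpow_neg] at e'
    exact hne (eq_of_zpow_eq_zpow hp e')
  ne_bd := fun e => hne (eq_of_zpow_eq_zpow hp (mul_left_cancel e))

theorem dual_mul_zpow {u w : V} (h : Commute (of G w) (of G u)) (g : RAAG G)
    {k : ℤ} (hk : k ≠ 0) : dual (g * of G w ^ k) u = dual g u := by
  by_cases hne : u = w
  · subst hne; exact dual_mul_zpow_self g u hk
  have hsq := isFourCycle_of_commute hne h.symm g (one_ne_zero (α := ℤ)) hk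
  have h1 := dual_contains (g * of G w ^ k) u (one_ne_zero (α := ℤ))
  rw [mul_assoc, ← (h.symm.zpow_zpow 1 k).eq, ← mul_assoc, Sym2.eq_swap] at h1
  refine eq_of_contains h1 ⟨hsq.adj_cd, ?_⟩
  exact (Quotient.sound (Relation.EqvGen.rel _ _ (EdgeStep.square _ _ _ _ hsq))).symm

/-- The centralizer of `u` moves the edge `{1, u}` within its hyperplane. -/
theorem dual_mul_of_commute {u : V} {c : RAAG G} (hc : Commute c (of G u)) (g : RAAG G) :
    dual (g * c) u = dual g u := by
  refine centralizer_induction (p := fun c => ∀ g, dual (g * c) u = dual g u) (fun g => ?_)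
    (fun w k c hk hw ih g => ?_) hc g
  · rw [mul_one]
  · rw [← mul_assoc, ih, dual_mul_zpow hw g hk]

theorem hyperplaneLabel_dual (g : RAAG G) (u : V) :
    hyperplaneLabel (dual g u) = g * of G u * g⁻¹ :=
  hyperplaneLabel_eq (dual_contains g u one_ne_zero) ⟨g, u, 1, one_ne_zero, rfl, rfl⟩

theorem exists_eq_dual (J : Hyperplane (qmGraph G)) : ∃ (g : RAAG G) (u : V), J = dual g u := by
  induction J using Quotient.inductionOn with
  | _ e =>
  obtain ⟨x, g, u, k, hk, e1, -⟩ := exists_isLabel e.2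
  refine ⟨g, u, eq_of_contains ⟨e.2, rfl⟩ ?_⟩
  rw [e1]
  exact dual_contains g u hk

theorem dual_eq_of_conj_eq {u v : V} {g h : RAAG G}
    (e : g * of G u * g⁻¹ = h * of G v * h⁻¹) : dual g u = dual h v := by
  obtain rfl := eq_of_conj_eq e
  have hc : Commute (h⁻¹ * g) (of G u) := by
    change h⁻¹ * g * of G u = of G u * (h⁻¹ * g)
    calc h⁻¹ * g * of G u = h⁻¹ * (g * of G u * g⁻¹) * g := by group
      _ = of G u * (h⁻¹ * g) := by rw [e]; group
  have := dual_mul_of_commute hc h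
  rwa [mul_inv_cancel_left] at this

theorem hyperplaneLabel_injective :
    Function.Injective (hyperplaneLabel : Hyperplane (qmGraph G) → RAAG G) := by
  intro J K e
  obtain ⟨g, u, rfl⟩ := exists_eq_dual J
  obtain ⟨h, v, rfl⟩ := exists_eq_dual K
  rw [hyperplaneLabel_dual, hyperplaneLabel_dual] at e
  exact dual_eq_of_conj_eq e

theorem commute_of_transverse {J K : Hyperplane (qmGraph G)} (h : J.Transverse K) :
    Commute (hyperplaneLabel J) (hyperplaneLabel K) := by
  obtain ⟨a, b, c, d, hsq, hJ, -, hK, -⟩ := h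
  obtain ⟨u, v, p, q, hp, hq, hc, rfl, rfl, -⟩ := IsFourCycle.exists_labels hsq
  rw [hyperplaneLabel_eq hJ (isLabel_mk.2 ⟨u, p, hp, rfl, rfl⟩),
    hyperplaneLabel_eq hK (isLabel_mk.2 ⟨v, q, hq, rfl, rfl⟩), conj_mul_zpow_of_commute hc]
  exact Commute.conj_iff _ |>.2 hc

theorem transverse_of_commute {J K : Hyperplane (qmGraph G)} (hne : J ≠ K)
    (h : Commute (hyperplaneLabel J) (hyperplaneLabel K)) : J.Transverse K := by
  obtain ⟨g, u, rfl⟩ := exists_eq_dual J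
  obtain ⟨k, v, rfl⟩ := exists_eq_dual K
  rw [hyperplaneLabel_dual, hyperplaneLabel_dual, commute_conj_iff] at h
  have e0 : g⁻¹ * (k * of G v * k⁻¹) * g = (g⁻¹ * k) * of G v * (g⁻¹ * k)⁻¹ := by group
  rw [e0] at h
  obtain ⟨c, hcu, hvu, e⟩ := exists_conj_of_commute h.symm
  have hJ : dual g u = dual (g * c) u := (dual_mul_of_commute hcu g).symm
  have hK : dual k v = dual (g * c) v := by
    apply dual_eq_of_conj_eq
    rw [← e0] at e
    calc k * of G v * k⁻¹ = g * (g⁻¹ * (k * of G v * k⁻¹) * g) * g⁻¹ := by group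
      _ = _ := by rw [e]; group
  rw [hJ, hK] at hne ⊢
  have huv : u ≠ v := by rintro rfl; exact hne rfl
  have one := one_ne_zero (α := ℤ)
  refine ⟨_, _, _, _, isFourCycle_of_commute huv hvu.symm (g * c) one one,
    dual_contains _ _ one, ?_, ?_, ?_⟩
  · rw [mul_assoc (g * c), (hvu.symm.zpow_zpow 1 1).eq, ← mul_assoc, Sym2.eq_swap,
      ← dual_mul_zpow hvu (g * c) one]
    exact dual_contains _ _ one
  · rw [← dual_mul_zpow hvu.symm (g * c) one]
    exact dual_contains _ _ one
  · rw [Sym2.eq_swap]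
    exact dual_contains _ _ one

/-- The isomorphism from the crossing graph of `QM(G)` to the extension graph of `G` that sends a
hyperplane to its label. -/
noncomputable def crossingGraphIso (G : SimpleGraph V) :
    crossingGraph (qmGraph G) ≃g extensionGraph G where
  toEquiv := Equiv.ofBijective
    (fun J => ⟨hyperplaneLabel J, by
      obtain ⟨g, u, rfl⟩ := exists_eq_dual J
      exact ⟨g, u, hyperplaneLabel_dual g u⟩⟩)
    ⟨fun J K e => hyperplaneLabel_injective (congrArg Subtype.val e), by
      rintro ⟨x, g, u, rfl⟩
      exact ⟨dual g u, Subtype.ext (hyperplaneLabel_dual g u)⟩⟩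
  map_rel_iff' := by
    intro J K
    have hiff {x y : {x : RAAG G // ∃ (g : RAAG G) (u : V), x = g * of G u * g⁻¹}} :
        (extensionGraph G).Adj x y ↔ x ≠ y ∧ Commute x.1 y.1 := Iff.rfl
    rw [hiff, (Equiv.injective _).ne_iff]
    exact and_congr_right fun hne => ⟨transverse_of_commute hne, commute_of_transverse⟩

end Hyperplanes

/-! ### Subgroups generated by large powers of conjugates of vertices -/

section Embedding

variable {V : Type*} {G : SimpleGraph V} {S : Type*} {Λ : SimpleGraph S}

/-- Large powers of finitely many conjugates of vertices generate a right-angled Artin group, on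
the graph recording which of these conjugates commute. -/
theorem exists_injective_hom [Finite S] (x : S → RAAG G)
    (hx : ∀ j, ∃ (g : RAAG G) (u : V), x j = g * of G u * g⁻¹) (hinj : Function.Injective x)
    (hadj : ∀ j k, j ≠ k → (Λ.Adj j k ↔ Commute (x j) (x k))) :
    ∃ f : RAAG Λ →* RAAG G, Function.Injective f := by
  choose g u hgu using hx
  -- the sectors of `j` containing the base point or one of the chosen hyperplanes
  let F : S → Set ℤ := fun j => insert 0 (Set.range fun k => crossing G (g k) (x j))
  have hF : (⋃ j, F j).Finite :=
    Set.finite_iUnion fun j => (Set.finite_range _).insert 0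
  obtain ⟨B, hB⟩ := (hF.image abs).bddAbove
  have hB' (j : S) (a : ℤ) (ha : a ∈ F j) : |a| ≤ B :=
    hB ⟨a, Set.mem_iUnion.2 ⟨j, ha⟩, rfl⟩
  -- the elements of `F j` have absolute value at most `B`, hence differences at most `2 * B < N`
  let N : ℤ := 2 * B + 1
  have hself (j : S) : crossing G (x j) (x j) = 1 := by rw [hgu j, crossing_conj_self]
  let f : RAAG Λ →* RAAG G := lift (fun j => x j ^ N) fun j k hjk =>
    ((hadj j k hjk.ne).1 hjk).zpow_zpow N N
  have hf (j : S) (n : ℤ) : f (of Λ j ^ n) = x j ^ (N * n) := by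
    rw [map_zpow, lift_of, zpow_mul]
  have hP : PingPong f (fun j h => crossing G h (x j)) F N := by
    refine ⟨fun j n h => ?_, fun j k hjk n h => ?_, fun j k hne hjk h => ?_, fun j => ?_,
      fun j a ha n hn => ?_⟩
    · rw [hf, crossing_zpow_mul_of_commute (Commute.refl _), hself]
      ring
    · have hc := ((hadj j k hjk.ne).1 hjk).symm
      have h0 : crossing G (x k) (x j) = 0 := by
        have hne : x j ≠ x k := fun e => hjk.ne (hinj e)
        rw [hgu k] at hc hne ⊢
        exact crossing_conj_of_commute hc hne
      rw [hf, crossing_zpow_mul_of_commute hc, h0]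
      ring
    · have hc : ¬ Commute (x j) (x k) := fun hc => hjk ((hadj j k hne).2 hc)
      rw [hgu j, hgu k] at hc
      have := crossing_eq_or_crossing_eq hc h
      rw [← hgu j, ← hgu k] at this
      exact this.imp (fun e => Or.inr ⟨k, e.symm⟩) fun e => Or.inr ⟨j, e.symm⟩
    · exact Or.inl (crossing_one _)
    · have h1 := abs_le.1 (hB' j a ha)
      have h2 := abs_le.1 (hB' j _ hn)
      by_contra hne
      have hB0 : 0 ≤ B := by linarith
      rcases lt_or_gt_of_ne hne with h | h
      · nlinarith
      · nlinarith
  exact ⟨f, hP.injective⟩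

end Embedding

end RAAG

theorem corollary3p4 {V : Type*} (Γ : SimpleGraph V) :
    (∃ φ : crossingGraph (qmGraph Γ) ≃g extensionGraph Γ,
      ∀ (J : Hyperplane (qmGraph Γ)) (g : RAAG Γ) (u : V) (k : ℤ),
        J.Contains s(g, g * RAAG.of Γ u ^ k) → (φ J).1 = g * RAAG.of Γ u * g⁻¹) ∧
    ∀ S : Set (Hyperplane (qmGraph Γ)), S.Finite →
      ∃ H : Subgroup (RAAG Γ),
        Nonempty (RAAG ((crossingGraph (qmGraph Γ)).induce S) ≃* H) := by
  refine ⟨⟨RAAG.crossingGraphIso Γ, fun J g u k hJ => ?_⟩, fun S hS => ?_⟩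
  · refine RAAG.hyperplaneLabel_eq hJ ⟨g, u, k, ?_, rfl, rfl⟩
    -- an edge is not a loop
    rintro rfl
    obtain ⟨he, -⟩ := hJ
    rw [zpow_zero, mul_one] at he
    exact (qmGraph Γ).irrefl he
  · have := hS.to_subtype
    obtain ⟨f, hf⟩ := RAAG.exists_injective_hom (Λ := (crossingGraph (qmGraph Γ)).induce S)
      (fun J => RAAG.hyperplaneLabel J.1)
      (fun J => (RAAG.crossingGraphIso Γ J.1).2)
      (fun J K e => Subtype.ext (RAAG.hyperplaneLabel_injective e))
      (fun J K hne => ⟨fun h => RAAG.commute_of_transverse h.2, fun h =>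
        ⟨fun e => hne (Subtype.ext e),
          RAAG.transverse_of_commute (fun e => hne (Subtype.ext e)) h⟩⟩)
    exact ⟨f.range, ⟨MonoidHom.ofInjective hf⟩⟩
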